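/- A \emph{tree} is a strict partially ordered set $\mathcal T=(Q,<)$ such that for each $x\in Q$ the set $\{v\in Q: v<x\}$ is well-ordered by $<$; the elements of $Q$ are its \emph{nodes}, the \emph{sons} of a node $x$ are the nodes $s>x$ with no node strictly between $x$ and $s$, and a \emph{branch} is an inclusion-maximal chain of nodes. A \emph{foliage tree} $\mathbf F$ is a tree together with a set $\mathbf F_x$ (the \emph{leaf} at $x$) for every node $x$. Let $X$ be a topological space. A \emph{$\pi$-tree on $X$} is a foliage tree $\mathbf F$ such that: (i) the tree is isomorphic to the tree ${}^{<\omega}\omega$ of all finite sequences of natural numbers ordered by proper extension; (ii) every leaf $\mathbf F_x$ is an open subset of $X$, and the leaf at the least node is $X$; (iii) for every node $x$, the leaf $\mathbf F_x$ is the union of the leaves at the sons of $x$, and the leaves at distinct sons of $x$ are disjoint; (iv) for every branch $B$, the intersection $\bigcap_{x\in B}\mathbf F_x$ is a singleton; (v) for every point $p\in X$ and every neighbourhood $U$ of $p$ there are a node $z$ with $p\in\mathbf F_z$ and a cofinite subset $C$ of the set of sons of $z$ such that $\varnothing\neq\bigcup_{x\in C}\mathbf F_x\subseteq U$. The space $X$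 \emph{has a $\pi$-tree} if there is a $\pi$-tree on $X$. Let $\mathcal R_S$ be the Sorgenfrey line, that is, the set of real numbers with the topology generated by the half-open intervals $[a,b)$, and let $\mathcal I_S=\mathcal R_S\setminus\mathbb Q$ be the irrational Sorgenfrey line, with the subspace topology. Powers carry the product topology. \textbf{Corollary.} (a) For every natural number $n\geq 1$, both $\mathcal R_S^{\,n}$ and $\mathcal I_S^{\,n}$ have a $\pi$-tree. (b) Both $\mathcal R_S^{\,\omega}$ and $\mathcal I_S^{\,\omega}$ have a $\pi$-tree. -/

import Mathlib

open Set Topology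

/-- A foliage tree with leaves in `X`: a tree (a strict partial order `<` in which the strict
predecessors of every node are well-ordered) together with a function assigning to every node a
subset of `X`, the leaf at that node. Only trees isomorphic to the countable tree of finite
sequences of natural numbers matter below, so a node set in `Type` is no restriction. -/
structure FoliageTree (X : Type*) where
  /-- The set of nodes. -/
  Node : Type
  /-- The order of the skeleton. -/
  order : PartialOrder Node
  /-- The skeleton is a tree. -/
  isWellOrder_Iio : ∀ x : Node, IsWellOrder (Set.Iio x) (· < ·)
  /-- The leaf at a node. -/
  leaf : Node → Set X

namespace FoliageTree

attribute [instance] FoliageTree.order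

variable {X : Type*} (F : FoliageTree X)

/-- The sons of `x`: the nodes `s > x` with no node strictly between `x` and `s`. -/
def sons (x : F.Node) : Set F.Node := {s | x ⋖ s}

/-- The union of the leaves at the nodes of `A`. -/
def flesh (A : Set F.Node) : Set X := ⋃ x ∈ A, F.leaf x

/-- All the sets `flesh C`, for `C` a cofinite subset of the set of sons of `v`. -/
def shoot (v : F.Node) : Set (Set X) :=
  {G | ∃ C : Set F.Node, C ⊆ F.sons v ∧ (F.sons v \ C).Finite ∧ G = F.flesh C}

/-- The nodes whose leaf contains `a`. -/
def scope (a : X) : Set F.Node := {x | a ∈ F.leaf x}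

/-- A branch: an inclusion-maximal chain of nodes. -/
def IsBranch (B : Set F.Node) : Prop := IsMaxChain (· ≤ ·) B

/-- The set of nodes is nonempty and the leaves along every branch meet in exactly one point. -/
def HasStrictBranches : Prop :=
  Nonempty F.Node ∧ ∀ B : Set F.Node, F.IsBranch B → ∃ p : X, (⋂ x ∈ B, F.leaf x) = {p}

/-- The leaf at every non-maximal node is the disjoint union of the leaves at its sons. -/
def IsLocallyStrict : Prop :=
  ∀ x : F.Node, ¬ IsMax x →
    F.leaf x = (⋃ s ∈ F.sons x, F.leaf s) ∧
      ∀ s ∈ F.sons x, ∀ t ∈ F.sons x, s ≠ t → F.leaf s ∩ F.leaf t = ∅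

/-- The skeleton is isomorphic to the tree of finite sequences of natural numbers, ordered by
proper extension. -/
def IsOmegaOmegaTree : Prop :=
  Nonempty (((· < ·) : F.Node → F.Node → Prop) ≃r
    (fun s t : List ℕ => s <+: t ∧ s ≠ t))

/-- Every leaf is open. -/
def IsOpenTree [TopologicalSpace X] : Prop := ∀ z : F.Node, IsOpen (F.leaf z)

/-- A Baire foliage tree on the space `X`: the tree is open in `X`, locally strict, isomorphic to
the tree of finite sequences of natural numbers, has strict branches, and its leaf at the least
node is `X`. -/
structure IsBaireFoliageTree [TopologicalSpace X] : Prop where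
  isOpenTree : F.IsOpenTree
  isLocallyStrict : F.IsLocallyStrict
  isOmegaOmegaTree : F.IsOmegaOmegaTree
  hasStrictBranches : F.HasStrictBranches
  leaf_bot : ∃ r : F.Node, IsBot r ∧ F.leaf r = Set.univ

end FoliageTree

/-- `γ` `π`-refines `δ`: every nonempty member of `δ` includes a nonempty member of `γ`. -/
def PiRefines {X : Type*} (γ δ : Set (Set X)) : Prop :=
  ∀ D ∈ δ \ {∅}, ∃ G ∈ γ \ {∅}, G ⊆ D

namespace FoliageTree

variable {X : Type*} [TopologicalSpace X] (F : FoliageTree X)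

/-- For every point `p` and every neighbourhood `U` of `p` there is a node whose leaf contains `p`
and whose shoot `π`-refines `{U}`. -/
def GrowsInto : Prop :=
  ∀ p : X, ∀ U ∈ 𝓝 p, ∃ z ∈ F.scope p, PiRefines (F.shoot z) {U}

/-- A `π`-tree on the space `X`. -/
def IsPiTree : Prop := F.IsBaireFoliageTree ∧ F.GrowsInto

end FoliageTree

/-- The space `X` has a `π`-tree. -/
def HasPiTree (X : Type*) [TopologicalSpace X] : Prop := ∃ F : FoliageTree X, F.IsPiTree

/-- The set of points of the Sorgenfrey line; a copy of `ℝ` that does not carry its topology. -/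
def SorgenfreyLine : Type := ℝ

/-- The real number underlying a point of the Sorgenfrey line. -/
def SorgenfreyLine.toReal : SorgenfreyLine ≃ ℝ := Equiv.refl ℝ

/-- The topology of the Sorgenfrey line, generated by the half-open intervals `[a, b)`. -/
instance : TopologicalSpace SorgenfreyLine :=
  TopologicalSpace.generateFrom {s | ∃ a b : ℝ, s = SorgenfreyLine.toReal ⁻¹' Set.Ico a b}

/-- The irrational Sorgenfrey line, the subspace of the Sorgenfrey line of all irrational points. -/
abbrev IrrationalSorgenfreyLine : Type := {x : SorgenfreyLine // Irrational x.toReal}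

/-! A continuous bijection `e` from `X` to the Baire space gives a foliage tree whose leaves are the
preimages of the basic cylinders; only growth into neighbourhoods remains, and `hasPiTree_of_code`
reduces it to a condition on codes. For powers, the alphabet is `ℕ × ℕ` and the condition is asked
at all late stages (`IsPairCode`). A basic neighbourhood in a product restricts finitely many
coordinates, so one late stage serves them all. The entries read at a stage are packed into one pair
whose first component is their minimum, so one lower bound controls every coordinate
(`IsPairCode.exists_pi`). On the line, `[a, b)` is cut repeatedly into half-open pieces indexed by
pairs, with left ends tending to `b` as the first index grows. Once the interval around `p` is
short, its pieces of large first index lie just to the right of `p`, as Sorgenfrey neighbourhoods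
require. Right ends strictly decrease, so nested intervals meet in a point; the stage `n` cut
discards the `n`-th missing real, so that point belongs to the space. -/

/-! ### The tree of finite sequences -/

/-- A finite sequence of natural numbers, as a node of a tree ordered by extension. -/
structure FinSeq where
  /-- The list of entries. -/
  toList : List ℕ

namespace FinSeq

@[ext] theorem ext {x y : FinSeq} (h : x.toList = y.toList) : x = y := by
  cases x; cases y; simpa using h

instance : PartialOrder FinSeq where
  le x y := x.toList <+: y.toList
  le_refl x := List.prefix_rfl
  le_trans x y z := List.IsPrefix.trans
  le_antisymm x y h k := ext (h.eq_of_length (le_antisymm h.length_le k.length_le))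

theorem le_def {x y : FinSeq} : x ≤ y ↔ x.toList <+: y.toList := Iff.rfl

theorem lt_iff {x y : FinSeq} : x < y ↔ x.toList <+: y.toList ∧ x.toList ≠ y.toList := by
  rw [lt_iff_le_and_ne, le_def, Ne, Ne, FinSeq.ext_iff]

theorem length_lt {x y : FinSeq} (h : x < y) : x.toList.length < y.toList.length := by
  rw [lt_iff] at h
  exact lt_of_le_of_ne h.1.length_le fun e => h.2 (h.1.eq_of_length e)

theorem isWellOrder_Iio (x : FinSeq) : IsWellOrder (Set.Iio x) (· < ·) := by
  have wf : WellFounded ((· < ·) : Set.Iio x → Set.Iio x → Prop) :=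
    Subrelation.wf (fun {a b} (h : a < b) => length_lt h)
      (InvImage.wf (fun a : Set.Iio x => a.1.toList.length) Nat.lt_wfRel.wf)
  have tri : ∀ a b : Set.Iio x, a < b ∨ a = b ∨ b < a := by
    intro a b
    rcases List.prefix_or_prefix_of_prefix (le_of_lt a.2 : a.1 ≤ x) (le_of_lt b.2 : b.1 ≤ x)
      with h | h
    · rcases eq_or_lt_of_le (show a ≤ b from h) with e | e
      · exact Or.inr (Or.inl e)
      · exact Or.inl e
    · rcases eq_or_lt_of_le (show b ≤ a from h) with e | e
      · exact Or.inr (Or.inl e.symm)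
      · exact Or.inr (Or.inr e)
  exact { wf := wf, trichotomous := fun a b h1 h2 => by
            rcases tri a b with h | h | h
            · exact absurd h h1
            · exact h
            · exact absurd h h2 }

/-- The initial segment of length `n` of an infinite sequence. -/
def take (s : ℕ → ℕ) (n : ℕ) : FinSeq := ⟨(List.range n).map s⟩

@[simp] theorem length_take (s : ℕ → ℕ) (n : ℕ) : (take s n).toList.length = n := by
  simp [take]

/-- The sequence extended by one entry. -/
def snoc (x : FinSeq) (a : ℕ) : FinSeq := ⟨x.toList ++ [a]⟩

theorem take_succ (s : ℕ → ℕ) (n : ℕ) : take s (n + 1) = (take s n).snoc (s n) := by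
  simp [take, snoc, List.range_succ]

theorem take_mono (s : ℕ → ℕ) : Monotone (take s) :=
  monotone_nat_of_le_succ fun n => by
    rw [take_succ]; exact List.prefix_append _ _

theorem take_eq_take {s t : ℕ → ℕ} {n : ℕ} : take s n = take t n ↔ ∀ i < n, s i = t i := by
  simp [take]

theorem snoc_injective {x y : FinSeq} {a b : ℕ} (h : x.snoc a = y.snoc b) : x = y ∧ a = b := by
  have := (FinSeq.ext_iff).1 h
  simp only [snoc] at this
  have := List.append_inj' this rfl
  exact ⟨ext this.1, by simpa using this.2⟩

theorem lt_snoc (x : FinSeq) (a : ℕ) : x < x.snoc a := by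
  rw [lt_iff]; simp [snoc]

theorem covBy_iff {x y : FinSeq} : x ⋖ y ↔ ∃ a, y = x.snoc a := by
  constructor
  · rintro ⟨h, k⟩
    obtain ⟨t, ht⟩ := (lt_iff.1 h).1
    cases t with
    | nil => exact absurd (by simpa using ht) (lt_iff.1 h).2
    | cons a t =>
      refine ⟨a, ?_⟩
      have hle : x.snoc a ≤ y := by
        rw [le_def, ← ht]; exact ⟨t, by simp [snoc]⟩
      rcases eq_or_lt_of_le hle with e | e
      · exact e.symm
      · exact absurd e (k (lt_snoc x a))
  · rintro ⟨a, rfl⟩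
    refine ⟨lt_snoc x a, fun z h1 h2 => ?_⟩
    have h1 := length_lt h1
    have h2 := length_lt h2
    simp [snoc] at h2
    omega

/-- Members of a chain agree wherever both are defined, so they glue to one sequence, padded with
`0` past the length of the chain. -/
theorem exists_eq_take_of_isChain {B : Set FinSeq} (hB : IsChain (· ≤ ·) B) :
    ∃ s : ℕ → ℕ, B ⊆ range (take s) := by
  classical
  have key : ∀ x ∈ B, ∀ y ∈ B, ∀ i, (hx : i < x.toList.length) → (hy : i < y.toList.length) →
      x.toList[i] = y.toList[i] := by
    intro x hx y hy i hi hj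
    rcases hB.total hx hy with h | h
    · exact List.IsPrefix.getElem h hi
    · exact (List.IsPrefix.getElem h hj).symm
  refine ⟨fun i => if h : ∃ x ∈ B, i < x.toList.length then
    h.choose.toList[i]'h.choose_spec.2 else 0, fun x hx => ⟨x.toList.length, ?_⟩⟩
  apply ext
  apply List.ext_getElem (by simp)
  intro i h1 h2
  have h : ∃ x ∈ B, i < x.toList.length := ⟨x, hx, h2⟩
  simp only [take, List.getElem_map, List.getElem_range, dif_pos h]
  exact key _ h.choose_spec.1 _ hx _ _ _

end FinSeq

/-! ### Foliage trees from codings -/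

/-- The foliage tree on finite sequences whose leaf at `l` consists of the points whose code
extends `l`. -/
def codeTree {X : Type*} (e : X → ℕ → ℕ) : FoliageTree X where
  Node := FinSeq
  order := inferInstance
  isWellOrder_Iio := FinSeq.isWellOrder_Iio
  leaf l := {x | FinSeq.take (e x) l.toList.length = l}

section codeTree

variable {X : Type*} (e : X → ℕ → ℕ)

theorem mem_leaf_codeTree {x : X} {l : FinSeq} :
    x ∈ (codeTree e).leaf l ↔ FinSeq.take (e x) l.toList.length = l := Iff.rfl

theorem mem_leaf_codeTree_take {x : X} {s : ℕ → ℕ} {n : ℕ} :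
    x ∈ (codeTree e).leaf (FinSeq.take s n) ↔ ∀ i < n, e x i = s i := by
  rw [mem_leaf_codeTree, FinSeq.length_take, FinSeq.take_eq_take]

theorem mem_leaf_codeTree_snoc {x : X} {l : FinSeq} {a : ℕ} :
    x ∈ (codeTree e).leaf (l.snoc a) ↔
      x ∈ (codeTree e).leaf l ∧ e x l.toList.length = a := by
  rw [mem_leaf_codeTree, mem_leaf_codeTree]
  have : (l.snoc a).toList.length = l.toList.length + 1 := by simp [FinSeq.snoc]
  rw [this, FinSeq.take_succ]
  constructor
  · exact FinSeq.snoc_injective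
  · rintro ⟨h1, h2⟩; rw [h1, h2]

theorem mem_sons_codeTree {l s : FinSeq} :
    s ∈ (codeTree e).sons l ↔ ∃ a, s = l.snoc a := FinSeq.covBy_iff

/-- Continuity makes the leaves open; bijectivity makes the leaves along each branch meet in exactly
one point. -/
theorem isBaireFoliageTree_codeTree [TopologicalSpace X] (hc : Continuous e)
    (hb : Function.Bijective e) : (codeTree e).IsBaireFoliageTree where
  isOpenTree l := by
    rw [isOpen_iff_mem_nhds]
    intro x hx
    have : ∀ᶠ y in 𝓝 x, ∀ i ∈ Finset.range l.toList.length, e y i = e x i := by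
      rw [Filter.eventually_all_finset]
      intro i _
      have hci : Continuous fun y => e y i := (continuous_apply i).comp hc
      exact hci.continuousAt.eventually (p := fun k => k = e x i)
        ((isOpen_discrete {e x i}).mem_nhds rfl)
    filter_upwards [this] with y hy
    rw [← (mem_leaf_codeTree e).1 hx, mem_leaf_codeTree_take]
    exact fun i hi => hy i (Finset.mem_range.2 hi)
  isLocallyStrict l _ := by
    constructor
    · ext x
      simp only [mem_iUnion, exists_prop]
      constructor
      · intro hx
        exact ⟨l.snoc (e x l.toList.length), (mem_sons_codeTree e).2 ⟨_, rfl⟩,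
          (mem_leaf_codeTree_snoc e).2 ⟨hx, rfl⟩⟩
      · rintro ⟨s, hs, hx⟩
        obtain ⟨a, rfl⟩ := (mem_sons_codeTree e).1 hs
        exact ((mem_leaf_codeTree_snoc e).1 hx).1
    · intro s hs t ht hst
      obtain ⟨a, rfl⟩ := (mem_sons_codeTree e).1 hs
      obtain ⟨b, rfl⟩ := (mem_sons_codeTree e).1 ht
      ext x
      simp only [mem_inter_iff, mem_empty_iff_false, iff_false, not_and]
      intro h1 h2
      refine hst ?_
      rw [← ((mem_leaf_codeTree_snoc e).1 h1).2, ← ((mem_leaf_codeTree_snoc e).1 h2).2]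
  isOmegaOmegaTree :=
    ⟨⟨⟨FinSeq.toList, FinSeq.mk, fun _ => rfl, fun _ => rfl⟩, FinSeq.lt_iff.symm⟩⟩
  hasStrictBranches := by
    refine ⟨⟨(⟨[]⟩ : FinSeq)⟩, fun B hB => ?_⟩
    obtain ⟨s, hs⟩ := FinSeq.exists_eq_take_of_isChain hB.1
    -- The initial segments of `s` form a chain, so maximality forces equality.
    have hBs : B = range (FinSeq.take s) := by
      refine hB.2 ?_ hs
      rintro _ ⟨m, rfl⟩ _ ⟨n, rfl⟩ _
      exact (le_total m n).imp (fun h => FinSeq.take_mono s h) (fun h => FinSeq.take_mono s h)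
    obtain ⟨p, hp⟩ := hb.2 s
    refine ⟨p, ?_⟩
    ext x
    subst hBs
    simp only [mem_iInter, mem_singleton_iff]
    constructor
    · intro h
      refine hb.1 ((funext fun n => ?_).trans hp.symm)
      exact ((mem_leaf_codeTree_take e).1 (h _ ⟨n + 1, rfl⟩) n n.lt_succ_self)
    · rintro rfl _ ⟨n, rfl⟩
      exact (mem_leaf_codeTree_take e).2 fun i _ => by rw [hp]
  leaf_bot := ⟨(⟨[]⟩ : FinSeq), fun l => List.nil_prefix, by
    ext x; simp [mem_leaf_codeTree, FinSeq.take]⟩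

/-- A space has a `π`-tree if its points are coded by the infinite sequences of natural numbers so
that, near every point, some finite initial segment of the code and a lower bound on the next entry
force a point into a prescribed neighbourhood. -/
theorem hasPiTree_of_code [TopologicalSpace X] (hc : Continuous e) (hb : Function.Bijective e)
    (h : ∀ p : X, ∀ U ∈ 𝓝 p, ∃ n N, ∀ x, (∀ i < n, e x i = e p i) → N ≤ e x n → x ∈ U) :
    HasPiTree X := by
  refine ⟨codeTree e, isBaireFoliageTree_codeTree e hc hb, fun p U hU => ?_⟩
  obtain ⟨n, N, hN⟩ := h p U hU
  let z := FinSeq.take (e p) n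
  have hz : z.toList.length = n := FinSeq.length_take _ _
  refine ⟨z, (mem_leaf_codeTree_take e).2 fun _ _ => rfl, ?_⟩
  rintro D ⟨rfl, -⟩
  refine ⟨(codeTree e).flesh (z.snoc '' Ici N), ⟨⟨z.snoc '' Ici N, ?_, ?_, rfl⟩, ?_⟩, ?_⟩
  · rintro _ ⟨a, _, rfl⟩
    exact (mem_sons_codeTree e).2 ⟨a, rfl⟩
  · refine ((finite_Iio N).image z.snoc).subset ?_
    rintro s ⟨hs, hs'⟩
    obtain ⟨a, rfl⟩ := (mem_sons_codeTree e).1 hs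
    exact ⟨a, not_le.1 fun h : N ≤ a => hs' ⟨a, h, rfl⟩, rfl⟩
  -- Surjectivity of the coding gives a point in the leaf at `z.snoc N`.
  · obtain ⟨x, hx⟩ := hb.2 fun i => if i < n then e p i else N
    refine Set.Nonempty.ne_empty ⟨x, ?_⟩
    simp only [FoliageTree.flesh, mem_iUnion]
    refine ⟨z.snoc N, ⟨N, self_mem_Ici, rfl⟩, (mem_leaf_codeTree_snoc e).2 ⟨?_, ?_⟩⟩
    · exact (mem_leaf_codeTree_take e).2 fun i hi => by simp [hx, hi]
    · simp [hx, hz]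
  · intro x hx
    simp only [FoliageTree.flesh, mem_iUnion] at hx
    obtain ⟨_, ⟨a, ha, rfl⟩, hx⟩ := hx
    have hx := (mem_leaf_codeTree_snoc e).1 hx
    rw [hz] at hx
    exact hN x ((mem_leaf_codeTree_take e).1 hx.1) (hx.2 ▸ ha)

end codeTree

/-! ### Pair codes and powers -/

/-- A coding of the points of `X` by sequences of pairs of natural numbers such that, from some
stage on, an initial segment of the code of `p` and a lower bound on the first component of the next
entry force a point into a prescribed neighbourhood of `p`. -/
structure IsPairCode {X : Type*} [TopologicalSpace X] (e : X → ℕ → ℕ × ℕ) : Prop where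
  continuous : Continuous e
  bijective : Function.Bijective e
  eventually_subset : ∀ p : X, ∀ U ∈ 𝓝 p, ∀ᶠ n in Filter.atTop,
    ∃ N, ∀ x, (∀ i < n, e x i = e p i) → N ≤ (e x n).1 → x ∈ U

/-- Each pair is written as two successive entries, first component first, so the bound falls on the
entry right after an initial segment of even length. -/
theorem IsPairCode.hasPiTree {X : Type*} [TopologicalSpace X] {e : X → ℕ → ℕ × ℕ}
    (he : IsPairCode e) : HasPiTree X := by
  let f : X → ℕ → ℕ := fun x k => if k % 2 = 0 then (e x (k / 2)).1 else (e x (k / 2)).2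
  have f0 : ∀ x n, f x (2 * n) = (e x n).1 := fun x n => by simp [f]
  have f1 : ∀ x n, f x (2 * n + 1) = (e x n).2 := fun x n => by
    have h1 : (2 * n + 1) % 2 = 1 := by omega
    have h2 : (2 * n + 1) / 2 = n := by omega
    simp [f, h1, h2]
  refine hasPiTree_of_code f ?_ ⟨?_, ?_⟩ ?_
  · refine continuous_pi fun k => ?_
    have h : Continuous fun x => e x (k / 2) := (continuous_apply _).comp he.continuous
    by_cases hk : k % 2 = 0
    · simpa [f, hk] using h.fst
    · simpa [f, hk] using h.snd
  · intro x y hxy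
    refine he.bijective.1 (funext fun n => Prod.ext ?_ ?_)
    · rw [← f0, ← f0, hxy]
    · rw [← f1, ← f1, hxy]
  · intro s
    obtain ⟨x, hx⟩ := he.bijective.2 fun n => (s (2 * n), s (2 * n + 1))
    refine ⟨x, funext fun k => ?_⟩
    rcases Nat.even_or_odd' k with ⟨n, rfl | rfl⟩
    · rw [f0, hx]
    · rw [f1, hx]
  · intro p U hU
    obtain ⟨n, N, hN⟩ := (he.eventually_subset p U hU).exists
    refine ⟨2 * n, N, fun x hx hxn => hN x (fun i hi => Prod.ext ?_ ?_) (f0 x n ▸ hxn)⟩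
    · rw [← f0, ← f0, hx _ (by omega)]
    · rw [← f1, ← f1, hx _ (by omega)]

/-- Finite nonempty families of pairs of natural numbers are coded by pairs of natural numbers so
that the first component of the code bounds from below the first components of the family. -/
theorem exists_equiv_fst_le (A : Type*) [Finite A] [Nonempty A] :
    ∃ c : (A → ℕ × ℕ) ≃ ℕ × ℕ, ∀ w i, (c w).1 ≤ (w i).1 := by
  classical
  -- The first component of the code is the minimum; each fibre of `m` is countably infinite, so the
  -- second component can enumerate it.
  let m : (A → ℕ × ℕ) → ℕ := fun w => ⨅ i, (w i).1
  have hfib : ∀ k, Nonempty ({w // m w = k} ≃ ℕ) := by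
    intro k
    have : Infinite {w // m w = k} :=
      Infinite.of_injective (fun l : ℕ => ⟨fun _ => (k, l), ciInf_const⟩) fun a b h => by
        have := congrFun (Subtype.ext_iff.1 h) (Classical.arbitrary A)
        exact (Prod.ext_iff.1 this).2
    obtain ⟨d⟩ := nonempty_denumerable {w // m w = k}
    exact ⟨Denumerable.eqv _⟩
  let g := fun k => (hfib k).some
  let c : (A → ℕ × ℕ) ≃ ℕ × ℕ :=
    (Equiv.sigmaFiberEquiv m).symm.trans
      ((Equiv.sigmaCongrRight g).trans (Equiv.sigmaEquivProd ℕ ℕ))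
  refine ⟨c, fun w i => ?_⟩
  have : (c w).1 = m w := rfl
  rw [this]
  exact ciInf_le (OrderBot.bddBelow _) i

/-- A power of a space with a pair code has a pair code, provided that the exponent can be exhausted
by finite nonempty sets: the coordinate `i` is read from the stage `d i` on. -/
theorem IsPairCode.exists_pi {S ι : Type*} [TopologicalSpace S] {e : S → ℕ → ℕ × ℕ}
    (he : IsPairCode e) (d : ι → ℕ) (hd : ∀ m, {i | d i ≤ m}.Finite) (h0 : ∃ i, d i = 0) :
    ∃ f : (ι → S) → ℕ → ℕ × ℕ, IsPairCode f := by
  have hc : ∀ m, ∃ c : ({i // d i ≤ m} → ℕ × ℕ) ≃ ℕ × ℕ, ∀ w i, (c w).1 ≤ (w i).1 := by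
    intro m
    have : Finite {i // d i ≤ m} := hd m
    have : Nonempty {i // d i ≤ m} := h0.elim fun i hi => ⟨⟨i, by omega⟩⟩
    exact exists_equiv_fst_le _
  choose c hc using hc
  let f : (ι → S) → ℕ → ℕ × ℕ := fun x m => c m fun i => e (x i) (m - d i)
  have hf : ∀ x y m, f x m = f y m → ∀ i j, j + d i = m → e (x i) j = e (y i) j := by
    rintro x y _ h i j rfl
    simpa using congrFun ((c _).injective h) ⟨i, by omega⟩
  refine ⟨f, ?_, ⟨?_, ?_⟩, ?_⟩
  · refine continuous_pi fun m => ?_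
    have : Finite {i // d i ≤ m} := hd m
    refine (continuous_of_discreteTopology (f := c m)).comp (continuous_pi fun i => ?_)
    exact (continuous_apply _).comp (he.continuous.comp (continuous_apply _))
  · intro x y hxy
    refine funext fun i => he.bijective.1 (funext fun j => ?_)
    exact hf x y _ (congrFun hxy _) i j rfl
  · intro s
    choose x hx using fun i => he.bijective.2
      fun j => (c (j + d i)).symm (s (j + d i)) ⟨i, by omega⟩
    refine ⟨x, funext fun m => ?_⟩
    rw [← (c m).apply_symm_apply (s m)]
    refine congrArg (c m) (funext fun ⟨i, hi⟩ => ?_)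
    obtain ⟨j, rfl⟩ := Nat.exists_eq_add_of_le' hi
    simp [hx]
  · intro p U hU
    rw [nhds_pi, Filter.mem_pi] at hU
    obtain ⟨I, hI, t, ht, htU⟩ := hU
    -- Here the condition at all late stages is needed: the finitely many coordinates in `I`, each
    -- with its delay `d i`, must succeed at the same stage.
    have : ∀ᶠ m in Filter.atTop, ∀ i ∈ I, d i ≤ m ∧
        ∃ N, ∀ y, (∀ j < m - d i, e y j = e (p i) j) → N ≤ (e y (m - d i)).1 → y ∈ t i := by
      rw [Filter.eventually_all_finite hI]
      intro i _
      exact (Filter.eventually_ge_atTop _).and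
        ((Filter.tendsto_sub_atTop_nat (d i)).eventually (he.eventually_subset (p i) _ (ht i)))
    filter_upwards [this] with m hm
    choose! hdm N hN using hm
    refine ⟨hI.toFinset.sup N, fun x hx hxm => htU fun i hi => ?_⟩
    refine hN i hi _ (fun j hj => hf x p (j + d i) (hx _ (by omega)) i j rfl) ?_
    exact (Finset.le_sup (hI.mem_toFinset.2 hi)).trans (hxm.trans (hc m _ ⟨i, hdm i hi⟩))

/-! ### Partitions of half-open intervals -/

/-- The cut points `b - (b - a) / (n + 1)` start at `a` and increase to `b`; the piece containing
`x` has index `⌊(x - a) / (b - x)⌋₊`. -/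
theorem exists_partition_Ico {a b : ℝ} (hab : a < b) : ∃ A B : ℕ → ℝ,
    (∀ n, a ≤ A n ∧ A n < B n ∧ B n < b ∧ B n - A n ≤ (b - a) / 2) ∧
    (∀ x ∈ Ico a b, ∃! n, x ∈ Ico (A n) (B n)) ∧
    ∀ p < b, ∃ N, ∀ n ≥ N, p ≤ A n := by
  let f : ℝ → ℝ := fun t => b - (b - a) / (t + 1)
  have hba : 0 < b - a := sub_pos.2 hab
  have hf : ∀ t : ℝ, 0 ≤ t → ∀ x < b, (f t ≤ x ↔ t ≤ (x - a) / (b - x)) := by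
    intro t ht x hx
    have hx' : 0 < b - x := sub_pos.2 hx
    rw [le_div_iff₀ hx', sub_le_comm, le_div_iff₀ (by positivity)]
    constructor <;> intro h <;> linarith
  have hf' : ∀ t : ℝ, 0 ≤ t → ∀ x < b, (x < f t ↔ (x - a) / (b - x) < t) := fun t ht x hx => by
    rw [← not_le, hf t ht x hx, not_le]
  refine ⟨fun n => f n, fun n => f (n + 1), fun n => ?_, fun x hx => ?_, fun p hp => ?_⟩
  · have hn : (0 : ℝ) ≤ n := n.cast_nonneg
    have h1 : (b - a) / ((n : ℝ) + 1) ≤ b - a := div_le_self hba.le (by linarith)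
    have h2 : 0 < (b - a) / ((n : ℝ) + 1 + 1) := by positivity
    have h3 : (b - a) / ((n : ℝ) + 1) - (b - a) / ((n : ℝ) + 1 + 1)
        = (b - a) / (((n : ℝ) + 1) * ((n : ℝ) + 1 + 1)) := by field_simp; ring
    have h4 : 0 < (b - a) / (((n : ℝ) + 1) * ((n : ℝ) + 1 + 1)) := by positivity
    have h5 : (b - a) / (((n : ℝ) + 1) * ((n : ℝ) + 1 + 1)) ≤ (b - a) / 2 :=
      div_le_div_of_nonneg_left hba.le two_pos (by nlinarith)
    simp only [f]
    refine ⟨?_, ?_, ?_, ?_⟩ <;> linarith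
  · have ht : 0 ≤ (x - a) / (b - x) := div_nonneg (sub_nonneg.2 hx.1) (sub_nonneg.2 hx.2.le)
    have key : ∀ n : ℕ, x ∈ Ico (f n) (f (n + 1)) ↔ ⌊(x - a) / (b - x)⌋₊ = n := fun n => by
      rw [Nat.floor_eq_iff ht, mem_Ico, hf _ n.cast_nonneg x hx.2, hf' _ (by positivity) x hx.2]
    exact ⟨_, (key _).2 rfl, fun n hn => ((key n).1 hn).symm⟩
  · obtain ⟨N, hN⟩ := exists_nat_gt ((p - a) / (b - p))
    refine ⟨N, fun n hn => ((hf' n n.cast_nonneg p hp).2 (hN.trans_le ?_)).le⟩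
    exact_mod_cast hn

/-- The unit intervals between consecutive integers are carried to `(a, b)` by an increasing
bijection. Both ends are avoided, which serves to drop a left end outside `T`. -/
theorem exists_partition_Ioo {a b : ℝ} (hab : a < b) : ∃ A B : ℕ → ℝ,
    (∀ n, a < A n ∧ A n < B n ∧ B n < b) ∧ ∀ x ∈ Ioo a b, ∃! n, x ∈ Ico (A n) (B n) := by
  let h := orderIsoIooNegOneOne ℝ
  let f : ℝ → ℝ := fun t => (a + b) / 2 + (b - a) / 2 * h t
  have hba : 0 < b - a := sub_pos.2 hab
  have hmono : StrictMono f := fun s t hst => by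
    have : (h s : ℝ) < h t := h.strictMono hst
    simp only [f]; nlinarith
  have hsurj : ∀ x ∈ Ioo a b, ∃ t, f t = x := by
    intro x hx
    have hy : (2 * x - (a + b)) / (b - a) ∈ Ioo (-1 : ℝ) 1 := by
      constructor
      · rw [lt_div_iff₀ hba]; linarith [hx.1]
      · rw [div_lt_iff₀ hba]; linarith [hx.2]
    refine ⟨h.symm ⟨_, hy⟩, ?_⟩
    simp only [f, OrderIso.apply_symm_apply]
    field_simp; ring
  let g : ℕ ≃ ℤ := (Denumerable.eqv ℤ).symm
  refine ⟨fun n => f (g n), fun n => f (g n + 1), fun n => ⟨?_, hmono (lt_add_one _), ?_⟩, ?_⟩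
  · have := (h (g n)).2.1
    simp only [f]; nlinarith
  · have := (h (g n + 1)).2.2
    simp only [f]; nlinarith
  · intro x hx
    obtain ⟨t, rfl⟩ := hsurj x hx
    have key : ∀ n, f t ∈ Ico (f (g n)) (f (g n + 1)) ↔ g.symm ⌊t⌋ = n := fun n => by
      rw [mem_Ico, hmono.le_iff_le, hmono.lt_iff_lt, g.symm_apply_eq, Int.floor_eq_iff]
    exact ⟨_, (key _).2 rfl, fun n hn => ((key n).1 hn).symm⟩

theorem exists_partition_inter (T : Set ℝ) {a b : ℝ} (hab : a < b) : ∃ A B : ℕ → ℝ,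
    (∀ n, a ≤ A n ∧ A n < B n ∧ B n < b ∧ (a ∉ T → a < A n)) ∧
    ∀ x ∈ Ico a b, x ∈ T → ∃! n, x ∈ Ico (A n) (B n) := by
  by_cases ha : a ∈ T
  · obtain ⟨A, B, h1, h2, -⟩ := exists_partition_Ico hab
    exact ⟨A, B, fun n => ⟨(h1 n).1, (h1 n).2.1, (h1 n).2.2.1, fun h => absurd ha h⟩,
      fun x hx _ => h2 x hx⟩
  · obtain ⟨A, B, h1, h2⟩ := exists_partition_Ioo hab
    exact ⟨A, B, fun n => ⟨(h1 n).1.le, (h1 n).2.1, (h1 n).2.2, fun _ => (h1 n).1⟩,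
      fun x hx hT => h2 x ⟨lt_of_le_of_ne hx.1 fun e => ha (e ▸ hT), hx.2⟩⟩

/-- The trace of `[a, b)` on `T` splits into countably many traces of half-open intervals, none of
which contains a given point outside `T`. -/
theorem exists_partition_avoiding (T : Set ℝ) {a b : ℝ} (hab : a < b) (q : ℝ) :
    ∃ A B : ℕ → ℝ, (∀ n, a ≤ A n ∧ A n < B n ∧ B n < b ∧ (q ∉ T → q ∉ Ico (A n) (B n))) ∧
      ∀ x ∈ Ico a b, x ∈ T → ∃! n, x ∈ Ico (A n) (B n) := by
  -- Cutting at `q` when it is interior leaves only left ends `a` and `c` as possible positions of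
  -- `q` in `[a, b)`, and a left end outside `T` can be dropped.
  obtain ⟨c, hac, hcb, hc⟩ : ∃ c, a < c ∧ c < b ∧ (q ∈ Ioo a b → q = c) := by
    by_cases h : q ∈ Ioo a b
    · exact ⟨q, h.1, h.2, fun _ => rfl⟩
    · obtain ⟨c, h1, h2⟩ := exists_between hab
      exact ⟨c, h1, h2, fun h' => absurd h' h⟩
  obtain ⟨A₀, B₀, h₀, k₀⟩ := exists_partition_inter T hac
  obtain ⟨A₁, B₁, h₁, k₁⟩ := exists_partition_inter T hcb
  let g : ℕ ≃ ℕ ⊕ ℕ := Equiv.natSumNatEquivNat.symm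
  have hq : ∀ x y : ℝ, a ≤ x → y < b → (q = a → q < x) → (q = c → q ∉ Ico x y) →
      q ∉ Ico x y := by
    intro x y hx hy ha hqc hqxy
    rcases eq_or_lt_of_le (hx.trans hqxy.1) with e | e
    · exact absurd hqxy.1 (not_le.2 (ha e.symm))
    · exact hqc (hc ⟨e, hqxy.2.trans hy⟩) hqxy
  refine ⟨fun n => Sum.elim A₀ A₁ (g n), fun n => Sum.elim B₀ B₁ (g n), fun n => ?_, ?_⟩
  · dsimp only
    rcases g n with i | i
    · obtain ⟨h1, h2, h3, h4⟩ := h₀ i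
      refine ⟨h1, h2, h3.trans hcb, fun hT => ?_⟩
      refine hq _ _ h1 (h3.trans hcb) ?_ ?_
      · rintro rfl; exact h4 hT
      · rintro rfl h; exact absurd h.2 (not_lt.2 h3.le)
    · obtain ⟨h1, h2, h3, h4⟩ := h₁ i
      refine ⟨hac.le.trans h1, h2, h3, fun hT => ?_⟩
      refine hq _ _ (hac.le.trans h1) h3 ?_ ?_
      · rintro rfl; exact hac.trans_le h1
      · rintro rfl h; exact absurd h.1 (not_le.2 (h4 hT))
  · intro x hx hT
    rcases lt_or_ge x c with h | h
    · obtain ⟨n, hn, hu⟩ := k₀ x ⟨hx.1, h⟩ hT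
      refine ⟨g.symm (Sum.inl n), by simpa using hn, fun m hm => ?_⟩
      rw [Equiv.eq_symm_apply]
      dsimp only at hm
      generalize g m = k at hm ⊢
      rcases k with i | i
      · rw [hu i hm]
      · exact absurd (hm.1 : A₁ i ≤ x) (not_le.2 (h.trans_le (h₁ i).1))
    · obtain ⟨n, hn, hu⟩ := k₁ x ⟨h, hx.2⟩ hT
      refine ⟨g.symm (Sum.inr n), by simpa using hn, fun m hm => ?_⟩
      rw [Equiv.eq_symm_apply]
      dsimp only at hm
      generalize g m = k at hm ⊢
      rcases k with i | i
      · exact absurd (hm.2 : x < B₀ i) (not_lt.2 ((h₀ i).2.2.1.le.trans h))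
      · rw [hu i hm]

/-- The first index runs over the pieces of `exists_partition_Ico`, giving the halving and the
convergence to `b`; the second cuts each of these so as to avoid `q`. -/
theorem exists_partition_pairs (T : Set ℝ) {a b : ℝ} (hab : a < b) (q : ℝ) :
    ∃ A B : ℕ × ℕ → ℝ,
      (∀ w, a ≤ A w ∧ A w < B w ∧ B w < b ∧ B w - A w ≤ (b - a) / 2 ∧
        (q ∉ T → q ∉ Ico (A w) (B w))) ∧
      (∀ x ∈ Ico a b, x ∈ T → ∃! w, x ∈ Ico (A w) (B w)) ∧
      ∀ p < b, ∃ N, ∀ w : ℕ × ℕ, N ≤ w.1 → p ≤ A w := by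
  obtain ⟨C, D, h, k, l⟩ := exists_partition_Ico hab
  choose A B hA hB using fun u => exists_partition_avoiding T (h u).2.1 q
  refine ⟨fun w => A w.1 w.2, fun w => B w.1 w.2, fun w => ?_, fun x hx hT => ?_, fun p hp => ?_⟩
  · obtain ⟨h1, h2, h3, h4⟩ := h w.1
    obtain ⟨k1, k2, k3, k4⟩ := hA w.1 w.2
    exact ⟨h1.trans k1, k2, k3.trans h3, by linarith, k4⟩
  · obtain ⟨u, hu, hu'⟩ := k x hx
    obtain ⟨v, hv, hv'⟩ := hB u x hu hT
    refine ⟨(u, v), hv, ?_⟩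
    rintro ⟨u₁, v₁⟩ hw
    obtain rfl := hu' u₁ ⟨(hA u₁ v₁).1.trans hw.1, hw.2.trans (hA u₁ v₁).2.2.1⟩
    rw [hv' v₁ hw]
  · obtain ⟨N, hN⟩ := l p hp
    exact ⟨N, fun w hw => (hN w.1 hw).trans (hA w.1 w.2).1⟩

/-! ### Pair codes from nested half-open intervals -/

/-- A space whose points are real numbers filling `[0, 1)` up to a countable set, with the topology
of the half-open intervals `[a, b)`, has a pair code. -/
theorem exists_isPairCode_of_real {S : Type*} [TopologicalSpace S] (r : S → ℝ)
    (hr : Function.Injective r) (hr01 : ∀ x, r x ∈ Ico (0 : ℝ) 1)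
    (hcount : (Ico (0 : ℝ) 1 \ range r).Countable) (hopen : ∀ a b, IsOpen (r ⁻¹' Ico a b))
    (hnhds : ∀ p, ∀ U ∈ 𝓝 p, ∃ b, r p < b ∧ r ⁻¹' Ico (r p) b ⊆ U) :
    ∃ e : S → ℕ → ℕ × ℕ, IsPairCode e := by
  obtain ⟨q, hq⟩ := countable_iff_exists_subset_range.1 hcount
  let I := {p : ℝ × ℝ // p.1 < p.2}
  let V : I → Set ℝ := fun J => Ico J.1.1 J.1.2
  choose A B hAB hpart htail using
    fun (n : ℕ) (J : I) => exists_partition_pairs (range r) J.2 (q n)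
  let step : ℕ → I → ℕ × ℕ → I := fun n J w => ⟨(A n J w, B n J w), (hAB n J w).2.1⟩
  let st : (ℕ → ℕ × ℕ) → ℕ → I := fun s n =>
    Nat.rec ⟨(0, 1), zero_lt_one⟩ (fun n J => step n J (s n)) n
  have st_succ : ∀ s n, st s (n + 1) = step n (st s n) (s n) := fun s n => rfl
  have st_congr : ∀ s t n, (∀ i < n, s i = t i) → st s n = st t n := by
    intro s t n
    induction n with
    | zero => intro _; rfl
    | succ n ih =>
      intro h
      rw [st_succ, st_succ, ih fun i hi => h i (by omega), h n (by omega)]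
  have st_len : ∀ s n, (st s n).1.2 - (st s n).1.1 ≤ (1 / 2) ^ n := by
    intro s n
    induction n with
    | zero => norm_num [st]
    | succ n ih =>
      rw [st_succ, pow_succ]
      have := (hAB n (st s n) (s n)).2.2.2.1
      simp only [step]
      linarith
  have uniq : ∀ x s t, (∀ n, r x ∈ V (st s n)) → ∀ n, r x ∈ V (st t n) → ∀ i < n, t i = s i := by
    intro x s t hs n
    induction n with
    | zero => intro _ i hi; omega
    | succ n ih =>
      intro ht i hi
      have h1 := hAB n (st t n) (t n)
      have hlt := ih ⟨h1.1.trans ht.1, ht.2.trans h1.2.2.1⟩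
      rcases Nat.lt_succ_iff_lt_or_eq.1 hi with h | rfl
      · exact hlt i h
      · have h2 := hs (i + 1)
        rw [st_succ] at h2 ht
        rw [st_congr t s i hlt] at ht
        exact (hpart i (st s i) (r x) (hs i) ⟨x, rfl⟩).unique ht h2
  have exist : ∀ x, ∃ s, ∀ n, r x ∈ V (st s n) := by
    intro x
    choose! w hw _ using fun n (J : I) (hJ : r x ∈ V J) => hpart n J (r x) hJ ⟨x, rfl⟩
    let J : ℕ → I := fun n => Nat.rec ⟨(0, 1), zero_lt_one⟩ (fun n J => step n J (w n J)) n
    have hJ : ∀ n, st (fun n => w n (J n)) n = J n := by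
      intro n
      induction n with
      | zero => rfl
      | succ n ih => rw [st_succ, ih]
    refine ⟨fun n => w n (J n), fun n => ?_⟩
    rw [hJ]
    induction n with
    | zero => exact hr01 x
    | succ n ih => exact hw n (J n) ih
  choose e he using exist
  have mem_iff : ∀ x s n, r x ∈ V (st s n) ↔ ∀ i < n, e x i = s i := by
    intro x s n
    refine ⟨fun h i hi => (uniq x (e x) s (he x) n h i hi).symm, fun h => ?_⟩
    rw [← st_congr _ _ _ h]
    exact he x n
  have small : ∀ ε > (0 : ℝ), ∀ᶠ n in Filter.atTop, (1 / 2 : ℝ) ^ n < ε := fun ε hε =>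
    (tendsto_pow_atTop_nhds_zero_of_lt_one (by norm_num) (by norm_num)).eventually_lt_const hε
  have tail : ∀ p U, U ∈ 𝓝 p → ∀ᶠ n in Filter.atTop,
      ∃ N, ∀ x, (∀ i < n, e x i = e p i) → N ≤ (e x n).1 → x ∈ U := by
    intro p U hU
    obtain ⟨b, hb, hbU⟩ := hnhds p U hU
    -- The stage `n` interval contains `r p` and is shorter than `b - r p`, so it ends before `b`;
    -- the bound `N` puts the left end of the next piece at or beyond `r p`.
    filter_upwards [small _ (sub_pos.2 hb)] with n hn
    have hp := he p n
    obtain ⟨N, hN⟩ := htail n (st (e p) n) (r p) hp.2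
    refine ⟨N, fun x hx hxN => hbU ⟨?_, ?_⟩⟩
    · have h := (he x (n + 1)).1
      rw [st_succ, st_congr _ _ n hx] at h
      exact (hN _ hxN).trans h
    · have h := ((mem_iff x (e p) n).2 hx).2
      have := st_len (e p) n
      have := hp.1
      linarith
  refine ⟨e, continuous_pi fun n => ?_, ⟨fun x y hxy => hr ?_, fun s => ?_⟩, tail⟩
  · refine (IsLocallyConstant.iff_eventually_eq _).2 (fun x => ?_) |>.continuous
    filter_upwards [(hopen _ _).mem_nhds (he x (n + 1))] with y hy
    exact (mem_iff y (e x) (n + 1)).1 hy n n.lt_succ_self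
  · by_contra hne
    obtain ⟨n, hn⟩ := (small _ (abs_pos.2 (sub_ne_zero.2 hne))).exists
    have h1 := he x n
    have h2 := he y n
    have h3 := st_len (e x) n
    rw [← hxy] at h2
    have : |r x - r y| ≤ (1 / 2) ^ n := by
      rw [abs_le]
      constructor <;> linarith [h1.1, h1.2, h2.1, h2.2]
    linarith
  · have lo_mono : Monotone fun n => (st s n).1.1 :=
      monotone_nat_of_le_succ fun n => (hAB n (st s n) (s n)).1
    have hi_anti : StrictAnti fun n => (st s n).1.2 :=
      strictAnti_nat_of_succ_lt fun n => (hAB n (st s n) (s n)).2.2.1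
    have lo_lt_hi : ∀ m n, (st s m).1.1 < (st s n).1.2 := fun m n =>
      (lo_mono (le_max_left m n)).trans_lt
        ((st s (max m n)).2.trans_le (hi_anti.antitone (le_max_right m n)))
    have bdd : BddAbove (range fun n => (st s n).1.1) :=
      ⟨1, by rintro _ ⟨m, rfl⟩; exact (lo_lt_hi m 0).le⟩
    -- The supremum is at most every right end, and strictly below since right ends strictly
    -- decrease.
    let x : ℝ := ⨆ n, (st s n).1.1
    have hx : ∀ n, x ∈ V (st s n) := fun n =>
      ⟨le_ciSup bdd n, (ciSup_le fun m => (lo_lt_hi m (n + 1)).le).trans_lt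
        (hi_anti n.lt_succ_self)⟩
    -- A limit outside the range would be some `q j`, which the cut at stage `j` excluded.
    have hxr : x ∈ range r := by
      by_contra hxr
      obtain ⟨j, hj⟩ := hq ⟨hx 0, hxr⟩
      exact (hAB j (st s j) (s j)).2.2.2.2 (hj ▸ hxr) (hj ▸ hx (j + 1))
    obtain ⟨y, hy⟩ := hxr
    exact ⟨y, funext fun n => (mem_iff y s (n + 1)).1 (hy ▸ hx (n + 1)) n n.lt_succ_self⟩

/-- A space whose points are real numbers filling the line up to a countable set, with the topology
of the half-open intervals `[a, b)`, has a pair code. -/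
theorem exists_isPairCode_of_countable_compl {S : Type*} [TopologicalSpace S] (r : S → ℝ)
    (hr : Function.Injective r) (hcount : (range r)ᶜ.Countable)
    (hopen : ∀ a b, IsOpen (r ⁻¹' Ico a b))
    (hnhds : ∀ p, ∀ U ∈ 𝓝 p, ∃ b, r p < b ∧ r ⁻¹' Ico (r p) b ⊆ U) :
    ∃ e : S → ℕ → ℕ × ℕ, IsPairCode e := by
  let h := orderIsoIooNegOneOne ℝ
  let f : ℝ → ℝ := fun t => (h t + 1) / 2
  have hmono : StrictMono f := fun s t hst => by
    have : (h s : ℝ) < h t := h.strictMono hst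
    simp only [f]; linarith
  have hf01 : ∀ t, f t ∈ Ioo (0 : ℝ) 1 := fun t => by
    have h1 := (h t).2.1
    have h2 := (h t).2.2
    constructor <;> simp only [f] <;> linarith
  have hsurj : ∀ y ∈ Ioo (0 : ℝ) 1, ∃ t, f t = y := fun y hy => by
    refine ⟨h.symm ⟨2 * y - 1, by constructor <;> linarith [hy.1, hy.2]⟩, ?_⟩
    simp only [f, OrderIso.apply_symm_apply]
    ring
  refine exists_isPairCode_of_real (f ∘ r) (hmono.injective.comp hr)
    (fun x => Ioo_subset_Ico_self (hf01 _)) ?_ ?_ ?_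
  -- The map `f` fills only `(0, 1)`, so `0` is one more missing point.
  · refine ((hcount.image f).insert 0).mono ?_
    rintro y ⟨hy, hyr⟩
    rcases eq_or_lt_of_le hy.1 with e | e
    · exact Or.inl e.symm
    · obtain ⟨t, rfl⟩ := hsurj y ⟨e, hy.2⟩
      refine Or.inr ⟨t, ?_, rfl⟩
      rintro ⟨x, rfl⟩
      exact hyr ⟨x, rfl⟩
  · intro a b
    rw [isOpen_iff_mem_nhds]
    intro x hx
    -- The ends `a` and `b` need not be values of `f`, so a smaller interval starting at `r x` is
    -- pulled back instead.
    obtain ⟨t, ht, htb⟩ : ∃ t, r x < t ∧ f t ≤ b := by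
      obtain ⟨y, hy1, hy2⟩ := exists_between (lt_min hx.2 (hf01 (r x)).2)
      obtain ⟨t, rfl⟩ := hsurj y ⟨(hf01 (r x)).1.trans hy1, hy2.trans_le (min_le_right _ _)⟩
      exact ⟨t, hmono.lt_iff_lt.1 hy1, hy2.le.trans (min_le_left _ _)⟩
    filter_upwards [(hopen (r x) t).mem_nhds ⟨le_rfl, ht⟩] with y hy
    exact ⟨hx.1.trans (hmono.monotone hy.1), (hmono hy.2).trans_le htb⟩
  · intro p U hU
    obtain ⟨b, hb, hbU⟩ := hnhds p U hU
    exact ⟨f b, hmono hb, fun x hx => hbU ⟨hmono.le_iff_le.1 hx.1, hmono.lt_iff_lt.1 hx.2⟩⟩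

/-! ### The two Sorgenfrey lines and their powers -/

namespace SorgenfreyLine

theorem isOpen_preimage_Ico (a b : ℝ) : IsOpen (toReal ⁻¹' Ico a b) :=
  TopologicalSpace.isOpen_generateFrom_of_mem ⟨a, b, rfl⟩

theorem exists_Ico_subset_of_mem_nhds {p : SorgenfreyLine} {U : Set SorgenfreyLine}
    (hU : U ∈ 𝓝 p) : ∃ b, toReal p < b ∧ toReal ⁻¹' Ico (toReal p) b ⊆ U := by
  obtain ⟨V, hVU, hV, hp⟩ := mem_nhds_iff.1 hU
  suffices ∃ b, toReal p < b ∧ toReal ⁻¹' Ico (toReal p) b ⊆ V from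
    this.imp fun b hb => ⟨hb.1, hb.2.trans hVU⟩
  clear hU hVU
  induction hV with
  | basic s hs =>
    obtain ⟨a, b, rfl⟩ := hs
    exact ⟨b, hp.2, fun x hx => ⟨hp.1.trans hx.1, hx.2⟩⟩
  | univ => exact ⟨toReal p + 1, lt_add_one _, subset_univ _⟩
  | inter s t _ _ hs ht =>
    obtain ⟨b, hb, hbs⟩ := hs hp.1
    obtain ⟨c, hc, hct⟩ := ht hp.2
    exact ⟨min b c, lt_min hb hc, fun x hx =>
      ⟨hbs ⟨hx.1, hx.2.trans_le (min_le_left _ _)⟩, hct ⟨hx.1, hx.2.trans_le (min_le_right _ _)⟩⟩⟩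
  | sUnion S _ ih =>
    obtain ⟨s, hs, hps⟩ := hp
    obtain ⟨b, hb, hbs⟩ := ih s hs hps
    exact ⟨b, hb, hbs.trans (subset_sUnion_of_mem hs)⟩

theorem exists_isPairCode : ∃ e : SorgenfreyLine → ℕ → ℕ × ℕ, IsPairCode e :=
  exists_isPairCode_of_countable_compl toReal toReal.injective
    (by simp [toReal.surjective.range_eq]) isOpen_preimage_Ico
    fun _ _ => exists_Ico_subset_of_mem_nhds

end SorgenfreyLine

theorem IrrationalSorgenfreyLine.exists_isPairCode :
    ∃ e : IrrationalSorgenfreyLine → ℕ → ℕ × ℕ, IsPairCode e := by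
  refine exists_isPairCode_of_countable_compl (fun x => x.1.toReal)
    (SorgenfreyLine.toReal.injective.comp Subtype.val_injective) ?_ ?_ ?_
  · refine (countable_range ((↑) : ℚ → ℝ)).mono fun y hy => ?_
    by_contra h
    exact hy ⟨⟨SorgenfreyLine.toReal.symm y, by simpa [Irrational] using h⟩, by simp⟩
  · exact fun a b => (SorgenfreyLine.isOpen_preimage_Ico a b).preimage continuous_subtype_val
  · intro p U hU
    obtain ⟨V, hV, hVU⟩ := mem_nhds_induced _ _ _ |>.1 hU
    obtain ⟨b, hb, hbV⟩ := SorgenfreyLine.exists_Ico_subset_of_mem_nhds hV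
    exact ⟨b, hb, fun x hx => hVU (hbV hx)⟩

theorem IsPairCode.hasPiTree_fin {S : Type*} [TopologicalSpace S] {e : S → ℕ → ℕ × ℕ}
    (he : IsPairCode e) {n : ℕ} (hn : 1 ≤ n) : HasPiTree (Fin n → S) :=
  (he.exists_pi (fun i : Fin n => (i : ℕ)) (fun _ => toFinite _) ⟨⟨0, hn⟩, rfl⟩).elim
    fun _ hf => hf.hasPiTree

theorem IsPairCode.hasPiTree_nat {S : Type*} [TopologicalSpace S] {e : S → ℕ → ℕ × ℕ}
    (he : IsPairCode e) : HasPiTree (ℕ → S) :=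
  (he.exists_pi (fun i : ℕ => i) finite_Iic ⟨0, rfl⟩).elim fun _ hf => hf.hasPiTree

theorem mainTheorem4 :
    (∀ n : ℕ, 1 ≤ n →
      HasPiTree (Fin n → SorgenfreyLine) ∧ HasPiTree (Fin n → IrrationalSorgenfreyLine)) ∧
    HasPiTree (ℕ → SorgenfreyLine) ∧ HasPiTree (ℕ → IrrationalSorgenfreyLine) := by
  obtain ⟨e, he⟩ := SorgenfreyLine.exists_isPairCode
  obtain ⟨f, hf⟩ := IrrationalSorgenfreyLine.exists_isPairCode
  exact ⟨fun n hn => ⟨he.hasPiTree_fin hn, hf.hasPiTree_fin hn⟩,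
    he.hasPiTree_nat, hf.hasPiTree_nat⟩
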